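/- **Theorem 1.4.** Define the Gauss map $T:[0,1)\to[0,1)$ by $T(0)=0$ and $T(x)=1/x \pmod 1$ for $0<x<1$, and for $x\in[0,1)$ let $a_n(x)=\lfloor 1/T^{n-1}(x)\rfloor$ ($n\ge 1$) be the partial quotients of its continued fraction expansion $x=[a_1(x),a_2(x),\dots]$ (for rational $x$ the expansion is finite, and we put $a_n(x)=0$ when $T^{n-1}(x)=0$). Let $\varphi:\{1,2,3,\dots\}\to(0,\infty)$ be non-decreasing, and let $\mathcal F_2(\varphi)$ be the set of all $x\in[0,1)$ such that for infinitely many $n\in\mathbb N$ there exist indices $k\ne l$ with $1\le k\le n$, $1\le l\le n$ and $$a_k(x)\,a_{k+1}(x)\ge\varphi(n),\qquad a_l(x)\,a_{l+1}(x)\ge\varphi(n).$$ Then the Lebesgue measure of $\mathcal F_2(\varphi)$ is $$\mathcal L\big(\mathcal F_2(\varphi)\big)=\begin{cases}0,&\text{if }\displaystyle\sum_{n=1}^\infty\frac{\varphi(n)+n\log^2\varphi(n)}{\varphi(n)^2}<\infty,\\[2ex]1,&\text{if }\displaystyle\sum_{n=1}^\infty\frac{\varphi(n)+n\log^2\varphi(n)}{\varphi(n)^2}=\infty,\end{cases}$$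 where $\log^2\varphi(n)=(\log\varphi(n))^2$. -/

import Mathlib

/-- The Gauss map `T(0) = 0`, `T(x) = 1/x mod 1`
(Lean's convention `1 / 0 = 0` gives `T(0) = 0`). -/
noncomputable def gaussMap (x : ℝ) : ℝ := Int.fract (1 / x)

/-- The `n`-th partial quotient `a_n(x) = ⌊1 / T^(n-1)(x)⌋` of `x ∈ [0,1)`, for `n ≥ 1`.
If `x` is rational with expansion of length less than `n`, the value is `0`. -/
noncomputable def partialQuotient (n : ℕ) (x : ℝ) : ℕ := ⌊1 / gaussMap^[n - 1] x⌋₊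

/-- The set of `x ∈ [0,1)` such that for infinitely many `n` there are `1 ≤ k ≠ l ≤ n` with
`a_k(x) a_{k+1}(x) ≥ φ(n)` and `a_l(x) a_{l+1}(x) ≥ φ(n)`. -/
def largeProductsSet (φ : ℕ → ℝ) : Set ℝ :=
  {x | x ∈ Set.Ico (0 : ℝ) 1 ∧
    {n : ℕ | ∃ k l : ℕ, 1 ≤ k ∧ k ≤ n ∧ 1 ≤ l ∧ l ≤ n ∧ k ≠ l ∧
      φ n ≤ (partialQuotient k x : ℝ) * (partialQuotient (k + 1) x : ℝ) ∧
      φ n ≤ (partialQuotient l x : ℝ) * (partialQuotient (l + 1) x : ℝ)}.Infinite}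

/-- The `n`-th term `(φ(n) + n log² φ(n)) / φ(n)²` of the series, for `n ≥ 1`. -/
noncomputable def seriesTerm (φ : ℕ → ℝ) (n : ℕ) : ℝ :=
  (φ n + (n : ℝ) * Real.log (φ n) ^ 2) / φ n ^ 2

/-!
Given the first `n` partial quotients of a Lebesgue distributed `x`, the law of `T^n x` has density
`(1 + θ) / (1 + θ x) ^ 2` with `θ = q_{n-1} / q_n` in `[0, 1]`. The family of these laws,
`tailLaw θ`, is stable under conditioning on one partial quotient and applying the Gauss map
(`exists_tailLaw_digit_inter`). Hence a bound for the probability of an event that is uniform in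
`θ` survives conditioning on any finite number of preceding partial quotients
(`tailLaw_inter_preimage_le`). This uniform Markov property replaces independence, and the ergodic
theory of the Gauss map is not needed.

Uniformly in `θ` and `t ≥ e`, the event `a_1 ≥ t` has probability of order `1 / t`, the event
`a_1 a_2 ≥ t` has probability of order `log t / t`, and the joint event `a_1 a_2 ≥ t, a_2 a_3 ≥ t`
has probability at most `10 / t`.

If the series converges, then `φ → ∞`, and a point with infinitely many pairs of large products
has infinitely many indices `m` with `a_m a_{m+1} ≥ φ m` and `a_k a_{k+1} ≥ φ m` for some `k < m`
(`frequently_of_mem_largeProductsSet`). The case `k = m - 1` has probability `O(1 / φ m)` and the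
remaining `k` contribute `O(m (log φ m / φ m) ^ 2)`; together this is the term of the series, and
the Borel–Cantelli lemma applies.

If the series diverges, one may assume `φ ≥ e`, and one of `∑ 1 / φ n` and
`∑ n (log φ n / φ n) ^ 2` diverges. In the first situation `a_n ≥ φ n` infinitely often, and such a
partial quotient makes two adjacent products large. In the second situation a dyadic block of `4 M`
partial quotients contains, in each of its halves, a product exceeding `t` with probability at
least `(y / (1 + y)) ^ 2`, where `y = M log t / (6 t)`; by Cauchy condensation these lower bounds
have divergent sum. Both situations end with the divergence half of the Borel–Cantelli lemma for
events read off from disjoint blocks of partial quotients (`ae_frequently_mem_preimage`).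
-/

open MeasureTheory Set Filter
open scoped ENNReal unitInterval Topology

/-! ### Irrational points of the unit interval and their partial quotients -/

/-- The irrational numbers of `(0, 1)`. The Gauss map sends this set to itself and all partial
quotients are positive on it. -/
def irrationalUnit : Set ℝ := {x | x ∈ Ioo (0 : ℝ) 1 ∧ Irrational x}

/-- The partial quotients indexed from `0`, so that `digit n x = a_{n+1}(x)`. -/
noncomputable def digit (n : ℕ) (x : ℝ) : ℕ := ⌊1 / gaussMap^[n] x⌋₊

theorem partialQuotient_succ (n : ℕ) (x : ℝ) : partialQuotient (n + 1) x = digit n x := rfl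

theorem digit_add (m n : ℕ) (x : ℝ) : digit (m + n) x = digit m (gaussMap^[n] x) := by
  simp only [digit, Function.iterate_add_apply]

theorem measurable_gaussMap : Measurable gaussMap :=
  measurable_fract.comp (measurable_const.div measurable_id)

theorem measurable_digit (n : ℕ) : Measurable (digit n) :=
  Nat.measurable_floor.comp (measurable_const.div (measurable_gaussMap.iterate n))

theorem measurableSet_irrationalUnit : MeasurableSet irrationalUnit :=
  measurableSet_Ioo.inter (countable_range ((↑) : ℚ → ℝ)).measurableSet.compl

theorem irrationalUnit_ae_eq_Ioo : irrationalUnit =ᵐ[volume] Ioo (0 : ℝ) 1 := by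
  have h : ∀ᵐ x : ℝ, Irrational x := (countable_range ((↑) : ℚ → ℝ)).ae_notMem volume
  filter_upwards [h] with x hx
  exact propext ⟨fun h => h.1, fun h => ⟨h, hx⟩⟩

theorem gaussMap_mem {x : ℝ} (hx : x ∈ irrationalUnit) : gaussMap x ∈ irrationalUnit := by
  have hirr : Irrational (Int.fract (1 / x)) := by
    rw [← Int.self_sub_floor, one_div]
    exact hx.2.inv.sub_intCast _
  exact ⟨⟨(Int.fract_nonneg _).lt_of_ne hirr.ne_zero.symm, Int.fract_lt_one _⟩, hirr⟩

theorem iterate_gaussMap_mem {x : ℝ} (hx : x ∈ irrationalUnit) (n : ℕ) :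
    gaussMap^[n] x ∈ irrationalUnit := by
  induction n with
  | zero => exact hx
  | succ n ih => rw [Function.iterate_succ_apply']; exact gaussMap_mem ih

theorem one_le_digit {x : ℝ} (hx : x ∈ irrationalUnit) (n : ℕ) : 1 ≤ digit n x := by
  have h := (iterate_gaussMap_mem hx n).1
  refine Nat.le_floor ?_
  rw [Nat.cast_one]
  exact (one_le_div h.1).2 h.2.le

theorem one_div_digit_add_gaussMap {x : ℝ} (hx : x ∈ irrationalUnit) :
    1 / ((digit 0 x : ℝ) + gaussMap x) = x := by
  have h0 : 0 ≤ 1 / x := one_div_nonneg.2 hx.1.1.le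
  have : (digit 0 x : ℝ) + gaussMap x = 1 / x := by
    simp only [digit, gaussMap, Function.iterate_zero, id]
    rw [natCast_floor_eq_intCast_floor h0]
    exact Int.floor_add_fract _
  rw [this, one_div_one_div]

theorem one_div_add_mem {y : ℝ} (hy : y ∈ irrationalUnit) {a : ℕ} (ha : 1 ≤ a) :
    1 / ((a : ℝ) + y) ∈ irrationalUnit := by
  have ha' : (1 : ℝ) ≤ a := by exact_mod_cast ha
  have h := hy.1.1
  refine ⟨⟨by positivity, ?_⟩, ?_⟩
  · rw [div_lt_one (by positivity)]; linarith
  · rw [one_div]; exact (hy.2.natCast_add a).inv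

theorem gaussMap_one_div_add {y : ℝ} (hy : y ∈ irrationalUnit) (a : ℕ) :
    gaussMap (1 / ((a : ℝ) + y)) = y := by
  rw [gaussMap, one_div_one_div, Int.fract_natCast_add]
  exact Int.fract_eq_self.2 ⟨hy.1.1.le, hy.1.2⟩

theorem digit_zero_one_div_add {y : ℝ} (hy : y ∈ irrationalUnit) (a : ℕ) :
    digit 0 (1 / ((a : ℝ) + y)) = a := by
  simp only [digit, Function.iterate_zero, id, one_div_one_div]
  refine (Nat.floor_eq_iff (add_nonneg a.cast_nonneg hy.1.1.le)).2 ⟨?_, ?_⟩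
  · linarith [hy.1.1]
  · linarith [hy.1.2]

theorem image_one_div_add {a : ℕ} (ha : 1 ≤ a) (E : Set ℝ) :
    (fun y : ℝ => 1 / ((a : ℝ) + y)) '' (irrationalUnit ∩ E) =
      irrationalUnit ∩ ({x | digit 0 x = a} ∩ gaussMap ⁻¹' E) := by
  ext x
  constructor
  · rintro ⟨y, ⟨hy, hE⟩, rfl⟩
    refine ⟨one_div_add_mem hy ha, digit_zero_one_div_add hy a, ?_⟩
    rw [mem_preimage, gaussMap_one_div_add hy]; exact hE
  · rintro ⟨hx, rfl, hE⟩
    exact ⟨gaussMap x, ⟨gaussMap_mem hx, hE⟩, one_div_digit_add_gaussMap hx⟩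

/-! ### The family of conditional laws -/

/-- The density of the conditional law of `T^n(x)` given the first `n` partial quotients of a
Lebesgue distributed `x`; the parameter is `θ = q_{n-1} / q_n`. -/
noncomputable def tailDensity (θ x : ℝ) : ℝ := (1 + θ) / (1 + θ * x) ^ 2

/-- The probability measure with density `tailDensity θ` on the irrationals of the unit
interval. For `θ = 0` it is Lebesgue measure. -/
noncomputable def tailLaw (θ : I) : Measure ℝ :=
  (volume.restrict irrationalUnit).withDensity fun x => ENNReal.ofReal (tailDensity θ x)

theorem measurable_tailDensity (θ : ℝ) : Measurable (tailDensity θ) := by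
  unfold tailDensity; fun_prop

theorem tailLaw_apply (θ : I) {E : Set ℝ} (hE : MeasurableSet E) :
    tailLaw θ E = ∫⁻ x in irrationalUnit ∩ E, ENNReal.ofReal (tailDensity θ x) := by
  rw [tailLaw, withDensity_apply _ hE, Measure.restrict_restrict hE, inter_comm]

theorem ae_mem_irrationalUnit (θ : I) : ∀ᵐ x ∂tailLaw θ, x ∈ irrationalUnit :=
  (withDensity_absolutelyContinuous _ _).ae_le
    (ae_restrict_mem measurableSet_irrationalUnit)

theorem tailLaw_mono (θ : I) {A B : Set ℝ} (h : ∀ x ∈ irrationalUnit, x ∈ A → x ∈ B) :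
    tailLaw θ A ≤ tailLaw θ B := by
  refine measure_mono_ae ?_
  filter_upwards [ae_mem_irrationalUnit θ] with x hx using h x hx

theorem tailLaw_congr (θ : I) {A B : Set ℝ} (h : ∀ x ∈ irrationalUnit, x ∈ A ↔ x ∈ B) :
    tailLaw θ A = tailLaw θ B :=
  le_antisymm (tailLaw_mono θ fun x hx => (h x hx).1) (tailLaw_mono θ fun x hx => (h x hx).2)

theorem tailLaw_zero : tailLaw 0 = volume.restrict irrationalUnit := by
  simp [tailLaw, tailDensity]

theorem tailLaw_Ioc (θ : I) {u : ℝ} (h0 : 0 ≤ u) (h1 : u ≤ 1) :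
    tailLaw θ (Ioc 0 u) = ENNReal.ofReal ((1 + θ) * u / (1 + θ * u)) := by
  have hθ : (0 : ℝ) ≤ θ := θ.2.1
  have hpos : ∀ x ∈ Icc (0 : ℝ) u, 0 < 1 + (θ : ℝ) * x := fun x hx => by
    have := mul_nonneg hθ hx.1; linarith
  have hset : (irrationalUnit ∩ Ioc 0 u : Set ℝ) =ᵐ[volume] Ioc 0 u := by
    have h2 : ({x | x ≠ 1} : Set ℝ) =ᵐ[volume] univ := by
      rw [ae_eq_univ]; simp
    filter_upwards [irrationalUnit_ae_eq_Ioo, h2] with x hx hx2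
    have h3 : x ≠ 1 := by
      have : ({x | x ≠ 1} : Set ℝ) x := by rw [hx2]; trivial
      exact this
    have hx' : x ∈ irrationalUnit ↔ x ∈ Ioo (0 : ℝ) 1 := iff_of_eq hx
    refine propext ⟨fun h => h.2, fun h => ⟨hx'.2 ⟨h.1, lt_of_le_of_ne (h.2.trans h1) h3⟩, h⟩⟩
  have hcont : ContinuousOn (tailDensity θ) (Icc 0 u) := by
    unfold tailDensity
    refine ContinuousOn.div (by fun_prop) (by fun_prop) fun x hx => ?_
    exact (pow_pos (hpos x hx) 2).ne'
  have hint : IntervalIntegrable (tailDensity θ) volume 0 u := by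
    apply ContinuousOn.intervalIntegrable; rwa [uIcc_of_le h0]
  rw [tailLaw_apply θ measurableSet_Ioc, Measure.restrict_congr_set hset,
    ← ofReal_integral_eq_lintegral_ofReal
      ((intervalIntegrable_iff_integrableOn_Ioc_of_le h0).1 hint),
    ← intervalIntegral.integral_of_le h0]
  · congr 1
    rw [intervalIntegral.integral_eq_sub_of_hasDerivAt
      (f := fun x => (1 + (θ : ℝ)) * x / (1 + θ * x)) _ hint]
    · simp
    · intro x hx
      rw [uIcc_of_le h0] at hx
      have hne := (hpos x hx).ne'
      have := ((hasDerivAt_id x).const_mul (1 + (θ : ℝ))).div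
        (((hasDerivAt_id x).const_mul (θ : ℝ)).const_add 1) hne
      refine this.congr_deriv ?_
      simp only [id, tailDensity]
      congr 1
      ring
  · refine Eventually.of_forall fun x => ?_
    simp only [tailDensity, Pi.zero_apply]
    positivity

theorem tailLaw_le_digit_zero (θ : I) {n : ℕ} (hn : 1 ≤ n) :
    tailLaw θ {x | n ≤ digit 0 x} = ENNReal.ofReal ((1 + θ) / (n + θ)) := by
  have hn' : (1 : ℝ) ≤ n := by exact_mod_cast hn
  have hθ : (0 : ℝ) ≤ θ := θ.2.1
  have h : tailLaw θ {x | n ≤ digit 0 x} = tailLaw θ (Ioc 0 (1 / n)) := by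
    refine tailLaw_congr θ fun x hx => ?_
    have hx0 := hx.1.1
    simp only [mem_ofPred_eq, digit, Function.iterate_zero, id, mem_Ioc, hx0, true_and]
    rw [Nat.le_floor_iff (by positivity), le_one_div (by positivity) hx0]
  rw [h, tailLaw_Ioc θ (by positivity) ((div_le_one (by positivity)).2 hn')]
  congr 1
  field_simp

instance (θ : I) : IsProbabilityMeasure (tailLaw θ) := by
  constructor
  have hθ : (0 : ℝ) ≤ θ := θ.2.1
  have h : tailLaw θ univ = tailLaw θ {x | 1 ≤ digit 0 x} :=
    tailLaw_congr θ fun x hx => ⟨fun _ => one_le_digit hx 0, fun _ => trivial⟩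
  rw [h, tailLaw_le_digit_zero θ le_rfl]
  rw [Nat.cast_one, div_self (by positivity), ENNReal.ofReal_one]

/-- The probability of `a_1 = a` under `tailLaw θ`. -/
noncomputable def digitProb (θ : ℝ) (a : ℕ) : ℝ := (1 + θ) / ((a + θ) * (a + 1 + θ))

/-- Conditionally on `a_1 = a`, the Gauss map turns `tailLaw θ` into another member of the same
family, the one with parameter `1 / (a + θ)`. -/
theorem exists_tailLaw_digit_inter (θ : I) {a : ℕ} (ha : 1 ≤ a) :
    ∃ θ' : I, ∀ E : Set ℝ, MeasurableSet E →
      tailLaw θ ({x | digit 0 x = a} ∩ gaussMap ⁻¹' E) =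
        ENNReal.ofReal (digitProb θ a) * tailLaw θ' E := by
  have ha' : (1 : ℝ) ≤ a := by exact_mod_cast ha
  have hθ : (0 : ℝ) ≤ θ := θ.2.1
  refine ⟨⟨1 / (a + θ), by positivity, (div_le_one (by positivity)).2 (by linarith)⟩,
    fun E hE => ?_⟩
  have hm : MeasurableSet ({x | digit 0 x = a} ∩ gaussMap ⁻¹' E) :=
    (measurable_digit 0 (measurableSet_singleton a)).inter (measurable_gaussMap hE)
  rw [tailLaw_apply θ hm, tailLaw_apply _ hE, ← image_one_div_add ha,
    lintegral_image_eq_lintegral_abs_deriv_mul (measurableSet_irrationalUnit.inter hE)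
      (f' := fun y => -(1 / ((a : ℝ) + y) ^ 2)),
    ← lintegral_const_mul _ (measurable_tailDensity _).ennreal_ofReal]
  · refine setLIntegral_congr_fun (measurableSet_irrationalUnit.inter hE) fun y hy => ?_
    have hy0 := hy.1.1.1
    rw [← ENNReal.ofReal_mul (abs_nonneg _), ← ENNReal.ofReal_mul (by unfold digitProb; positivity)]
    congr 1
    rw [abs_neg, abs_of_nonneg (by positivity)]
    simp only [tailDensity, digitProb]
    field_simp
    ring
  · intro y hy
    have hy0 := hy.1.1.1
    have := ((hasDerivAt_id y).const_add (a : ℝ)).inv (by simp only [id]; positivity)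
    simp only [one_div, id] at this ⊢
    refine (this.congr_deriv ?_).hasDerivWithinAt
    simp [neg_div]
  · intro x hx y hy hxy
    have hx0 := hx.1.1.1
    have hy0 := hy.1.1.1
    have := one_div_one_div ((a : ℝ) + x)
    rw [show 1 / ((a : ℝ) + x) = 1 / ((a : ℝ) + y) from hxy, one_div_one_div] at this
    linarith

theorem tailLaw_digit_eq (θ : I) {a : ℕ} (ha : 1 ≤ a) :
    tailLaw θ {x | digit 0 x = a} = ENNReal.ofReal (digitProb θ a) := by
  obtain ⟨θ', h⟩ := exists_tailLaw_digit_inter θ ha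
  simpa using h univ MeasurableSet.univ

/-! ### Conditioning on finitely many partial quotients -/

/-- Membership in `A` depends on the first `n` partial quotients only (for irrational points
of the unit interval). -/
def DeterminedBy (n : ℕ) (A : Set ℝ) : Prop :=
  ∀ x ∈ irrationalUnit, ∀ y ∈ irrationalUnit,
    (∀ i < n, digit i x = digit i y) → x ∈ A → y ∈ A

theorem DeterminedBy.mono {m n : ℕ} {A : Set ℝ} (h : DeterminedBy m A) (hmn : m ≤ n) :
    DeterminedBy n A :=
  fun x hx y hy hxy => h x hx y hy fun i hi => hxy i (hi.trans_le hmn)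

theorem DeterminedBy.inter {n : ℕ} {A B : Set ℝ} (hA : DeterminedBy n A)
    (hB : DeterminedBy n B) : DeterminedBy n (A ∩ B) :=
  fun x hx y hy hxy h => ⟨hA x hx y hy hxy h.1, hB x hx y hy hxy h.2⟩

theorem DeterminedBy.compl {n : ℕ} {A : Set ℝ} (hA : DeterminedBy n A) : DeterminedBy n Aᶜ :=
  fun x hx y hy hxy h hy' => h (hA y hy x hx (fun i hi => (hxy i hi).symm) hy')

theorem DeterminedBy.preimage {n : ℕ} {A : Set ℝ} (hA : DeterminedBy n A) (m : ℕ) :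
    DeterminedBy (m + n) (gaussMap^[m] ⁻¹' A) := by
  intro x hx y hy hxy h
  refine hA _ (iterate_gaussMap_mem hx m) _ (iterate_gaussMap_mem hy m) (fun i hi => ?_) h
  rw [← digit_add, ← digit_add]
  exact hxy _ (by omega)

theorem determinedBy_setOf_digit (P : ℕ → Prop) : DeterminedBy 1 {x | P (digit 0 x)} := by
  intro x _ y _ hxy h
  simpa only [mem_ofPred_eq, hxy 0 one_pos] using h

theorem determinedBy_setOf_digit_digit (P : ℕ → ℕ → Prop) :
    DeterminedBy 2 {x | P (digit 0 x) (digit 1 x)} := by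
  intro x _ y _ hxy h
  simpa only [mem_ofPred_eq, hxy 0 two_pos, hxy 1 one_lt_two] using h

theorem tailLaw_eq_tsum (θ : I) {S : Set ℝ} (hS : MeasurableSet S) :
    tailLaw θ S = ∑' a : ℕ, tailLaw θ ({x | digit 0 x = a} ∩ S) := by
  rw [← measure_iUnion]
  · congr 1; ext x; simp
  · intro a b hab
    refine Set.disjoint_left.2 ?_
    rintro x ⟨rfl, _⟩ ⟨h, _⟩
    exact hab h
  · exact fun a => (measurable_digit 0 (measurableSet_singleton a)).inter hS

/-- A uniform upper bound for the laws `tailLaw θ` of an event remains valid after shifting the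
event by `n` partial quotients and conditioning on these. -/
theorem tailLaw_inter_preimage_le {n : ℕ} {A : Set ℝ} (hA : DeterminedBy n A)
    (hAm : MeasurableSet A) {E : Set ℝ} (hE : MeasurableSet E) {c : ℝ≥0∞}
    (hc : ∀ θ, tailLaw θ E ≤ c) (θ : I) :
    tailLaw θ (A ∩ gaussMap^[n] ⁻¹' E) ≤ c * tailLaw θ A := by
  induction n generalizing A θ with
  | zero =>
    by_cases h : ∃ x ∈ irrationalUnit, x ∈ A
    · obtain ⟨x, hx, hxA⟩ := h
      have h1 : tailLaw θ A = 1 := by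
        rw [tailLaw_congr θ (B := univ), measure_univ]
        exact fun y hy => ⟨fun _ => trivial, fun _ => hA x hx y hy (by simp) hxA⟩
      rw [h1, mul_one]
      exact (measure_mono inter_subset_right).trans (hc θ)
    · push Not at h
      refine (tailLaw_mono θ (B := ∅) fun x hx hxA => h x hx hxA.1).trans (by simp)
  | succ n ih =>
    have hm : MeasurableSet (A ∩ gaussMap^[n + 1] ⁻¹' E) :=
      hAm.inter (measurable_gaussMap.iterate _ hE)
    rw [tailLaw_eq_tsum θ hm, tailLaw_eq_tsum θ hAm, ← ENNReal.tsum_mul_left]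
    refine ENNReal.tsum_le_tsum fun a => ?_
    rcases Nat.eq_zero_or_pos a with rfl | ha
    · refine (tailLaw_mono θ (B := ∅) fun x hx hxA => ?_).trans (by simp)
      have := one_le_digit hx 0
      have h0 : digit 0 x = 0 := hxA.1
      omega
    -- the trace of `A` on the cylinder `a_1 = a`, seen through the Gauss map
    set B : Set ℝ := (fun y : ℝ => 1 / ((a : ℝ) + y)) ⁻¹' A with hB
    have hBm : MeasurableSet B := by
      have : Measurable fun y : ℝ => 1 / ((a : ℝ) + y) := by fun_prop
      exact this hAm
    have hBd : DeterminedBy n B := by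
      intro x hx y hy hxy h
      refine hA _ (one_div_add_mem hx ha) _ (one_div_add_mem hy ha) (fun i hi => ?_) h
      rcases i with _ | i
      · rw [digit_zero_one_div_add hx, digit_zero_one_div_add hy]
      · rw [digit_add, digit_add, Function.iterate_one, gaussMap_one_div_add hx,
          gaussMap_one_div_add hy]
        exact hxy i (by omega)
    obtain ⟨θ', h⟩ := exists_tailLaw_digit_inter θ ha
    have h1 : tailLaw θ ({x | digit 0 x = a} ∩ (A ∩ gaussMap^[n + 1] ⁻¹' E)) =
        tailLaw θ ({x | digit 0 x = a} ∩ gaussMap ⁻¹' (B ∩ gaussMap^[n] ⁻¹' E)) := by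
      refine tailLaw_congr θ fun x hx => and_congr_right fun hxa => ?_
      have hxa : digit 0 x = a := hxa
      have h2 := one_div_digit_add_gaussMap hx
      rw [hxa] at h2
      simp only [hB, mem_inter_iff, mem_preimage, h2, Function.iterate_succ_apply]
    have h1' : tailLaw θ ({x | digit 0 x = a} ∩ A) =
        tailLaw θ ({x | digit 0 x = a} ∩ gaussMap ⁻¹' B) := by
      refine tailLaw_congr θ fun x hx => and_congr_right fun hxa => ?_
      have hxa : digit 0 x = a := hxa
      have h2 := one_div_digit_add_gaussMap hx
      rw [hxa] at h2
      simp only [hB, mem_preimage, h2]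
    rw [h1, h1', h _ (hBm.inter (measurable_gaussMap.iterate n hE)), h _ hBm, mul_left_comm]
    gcongr
    exact ih hBd hBm θ'

theorem tailLaw_real_inter_preimage_le {n : ℕ} {A : Set ℝ} (hA : DeterminedBy n A)
    (hAm : MeasurableSet A) {E : Set ℝ} (hE : MeasurableSet E) {c : ℝ}
    (hc : ∀ θ, (tailLaw θ).real E ≤ c) (θ : I) :
    (tailLaw θ).real (A ∩ gaussMap^[n] ⁻¹' E) ≤ c * (tailLaw θ).real A := by
  have h0 : 0 ≤ c := measureReal_nonneg.trans (hc θ)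
  have h := tailLaw_inter_preimage_le hA hAm hE (c := ENNReal.ofReal c)
    (fun θ => (ENNReal.le_ofReal_iff_toReal_le (measure_ne_top _ _) h0).2 (hc θ)) θ
  have := ENNReal.toReal_mono (ENNReal.mul_ne_top ENNReal.ofReal_ne_top (measure_ne_top _ _)) h
  rwa [ENNReal.toReal_mul, ENNReal.toReal_ofReal h0] at this

theorem tailLaw_real_preimage_le (n : ℕ) {E : Set ℝ} (hE : MeasurableSet E) {c : ℝ}
    (hc : ∀ θ, (tailLaw θ).real E ≤ c) (θ : I) :
    (tailLaw θ).real (gaussMap^[n] ⁻¹' E) ≤ c := by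
  have := tailLaw_real_inter_preimage_le (n := n) (A := univ) (fun _ _ _ _ _ _ => trivial)
    MeasurableSet.univ hE hc θ
  simpa using this

theorem tailLaw_real_mono (θ : I) {A B : Set ℝ} (h : ∀ x ∈ irrationalUnit, x ∈ A → x ∈ B) :
    (tailLaw θ).real A ≤ (tailLaw θ).real B :=
  ENNReal.toReal_mono (measure_ne_top _ _) (tailLaw_mono θ h)

/-! ### Divergence half of the Borel–Cantelli lemma -/

/-- The points for which none of the events `T^{-N j} (C j)`, `J ≤ j < J + k`, occurs. -/
def avoidSet (N : ℕ → ℕ) (C : ℕ → Set ℝ) (J : ℕ) : ℕ → Set ℝ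
  | 0 => univ
  | k + 1 => avoidSet N C J k ∩ gaussMap^[N (J + k)] ⁻¹' (C (J + k))ᶜ

theorem measurableSet_avoidSet {N : ℕ → ℕ} {C : ℕ → Set ℝ} (hm : ∀ j, MeasurableSet (C j))
    (J k : ℕ) : MeasurableSet (avoidSet N C J k) := by
  induction k with
  | zero => exact MeasurableSet.univ
  | succ k ih => exact ih.inter (measurable_gaussMap.iterate _ (hm _).compl)

theorem determinedBy_avoidSet {N L : ℕ → ℕ} (hN : ∀ j, N (j + 1) = N j + L j)
    {C : ℕ → Set ℝ} (hC : ∀ j, DeterminedBy (L j) (C j)) (J k : ℕ) :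
    DeterminedBy (N (J + k)) (avoidSet N C J k) := by
  induction k with
  | zero => exact fun _ _ _ _ _ _ => trivial
  | succ k ih =>
    have h := hN (J + k)
    rw [← add_assoc, h]
    exact (ih.mono (Nat.le_add_right _ _)).inter ((hC _).compl.preimage _)

theorem tailLaw_avoidSet_le {N L : ℕ → ℕ} (hN : ∀ j, N (j + 1) = N j + L j)
    {C : ℕ → Set ℝ} (hC : ∀ j, DeterminedBy (L j) (C j)) (hm : ∀ j, MeasurableSet (C j))
    {q : ℕ → ℝ} (hq : ∀ j θ, q j ≤ (tailLaw θ).real (C j)) (J k : ℕ) (θ : I) :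
    (tailLaw θ).real (avoidSet N C J k) ≤
      Real.exp (-∑ i ∈ Finset.range k, q (J + i)) := by
  induction k with
  | zero => simp [avoidSet]
  | succ k ih =>
    have hc : ∀ θ, (tailLaw θ).real (C (J + k))ᶜ ≤ Real.exp (-q (J + k)) := fun θ => by
      rw [probReal_compl_eq_one_sub (hm _)]
      have := Real.add_one_le_exp (-q (J + k))
      linarith [hq (J + k) θ]
    refine (tailLaw_real_inter_preimage_le (determinedBy_avoidSet hN hC J k)
      (measurableSet_avoidSet hm J k) (hm _).compl hc θ).trans ?_
    rw [Finset.sum_range_succ, neg_add_rev, Real.exp_add]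
    gcongr

/-- If the events `C j` have probability at least `q j` under every law `tailLaw θ`, are read off
from successive disjoint blocks of partial quotients, and `∑ q j = ∞`, then almost surely
infinitely many of them occur. -/
theorem ae_frequently_mem_preimage {N L : ℕ → ℕ} (hN : ∀ j, N (j + 1) = N j + L j)
    {C : ℕ → Set ℝ} (hC : ∀ j, DeterminedBy (L j) (C j)) (hm : ∀ j, MeasurableSet (C j))
    {q : ℕ → ℝ} (hq : ∀ j θ, q j ≤ (tailLaw θ).real (C j)) (hq0 : ∀ j, 0 ≤ q j)
    (hsum : ¬ Summable q) (θ : I) :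
    ∀ᵐ x ∂tailLaw θ, ∃ᶠ j in atTop, gaussMap^[N j] x ∈ C j := by
  have key : ∀ J, tailLaw θ {x | ∀ j, J ≤ j → gaussMap^[N j] x ∉ C j} = 0 := by
    intro J
    rw [← measureReal_eq_zero_iff]
    refine le_antisymm ?_ measureReal_nonneg
    have hdiv : ¬ Summable fun i => q (J + i) := by
      have := (summable_nat_add_iff (f := q) J).not.2 hsum
      simpa only [add_comm] using this
    have ht := (not_summable_iff_tendsto_nat_atTop_of_nonneg fun i => hq0 (J + i)).1 hdiv
    have h0 := Real.tendsto_exp_atBot.comp (tendsto_neg_atTop_atBot.comp ht)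
    refine ge_of_tendsto' h0 fun k => ?_
    refine (measureReal_mono ?_).trans (tailLaw_avoidSet_le hN hC hm hq J k θ)
    intro x hx
    induction k with
    | zero => trivial
    | succ k ih => exact ⟨ih, hx (J + k) (Nat.le_add_right _ _)⟩
  have h : ∀ᵐ x ∂tailLaw θ, ∀ J, x ∉ {x | ∀ j, J ≤ j → gaussMap^[N j] x ∉ C j} :=
    ae_all_iff.2 fun J => measure_eq_zero_iff_ae_notMem.1 (key J)
  filter_upwards [h] with x hx
  rw [frequently_atTop]
  intro J
  have := hx J
  simp only [not_forall, not_not] at this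
  obtain ⟨j, hj, h⟩ := this
  exact ⟨j, hj, h⟩

/-! ### Probabilities of large partial quotients and large products -/

theorem digitProb_le {θ : ℝ} (h0 : 0 ≤ θ) (h1 : θ ≤ 1) {a : ℕ} (ha : 1 ≤ a) :
    digitProb θ a ≤ 2 / (a : ℝ) ^ 2 := by
  have ha' : (1 : ℝ) ≤ a := by exact_mod_cast ha
  rw [digitProb, div_le_div_iff₀ (by positivity) (by positivity)]
  nlinarith [mul_nonneg h0 (by positivity : (0 : ℝ) ≤ a), sq_nonneg θ,
    mul_le_mul_of_nonneg_right h1 (sq_nonneg (a : ℝ))]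

theorem le_digitProb {θ : ℝ} (h0 : 0 ≤ θ) (h1 : θ ≤ 1) {a : ℕ} (ha : 1 ≤ a) :
    1 / (3 * (a : ℝ) ^ 2) ≤ digitProb θ a := by
  have ha' : (1 : ℝ) ≤ a := by exact_mod_cast ha
  rw [digitProb, div_le_div_iff₀ (by positivity) (by positivity), one_mul]
  have h2 : (a : ℝ) + θ ≤ a * (1 + θ) := by nlinarith
  have h3 : (a : ℝ) + 1 + θ ≤ 3 * a := by linarith
  calc ((a : ℝ) + θ) * (a + 1 + θ) ≤ a * (1 + θ) * (3 * a) := by gcongr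
    _ = (1 + θ) * (3 * (a : ℝ) ^ 2) := by ring

theorem tailLaw_real_digit_eq_le (θ : I) {a : ℕ} (ha : 1 ≤ a) :
    (tailLaw θ).real {x | digit 0 x = a} ≤ 2 / (a : ℝ) ^ 2 := by
  rw [measureReal_def, tailLaw_digit_eq θ ha]
  exact ENNReal.toReal_le_of_le_ofReal (by positivity)
    (ENNReal.ofReal_le_ofReal (digitProb_le θ.2.1 θ.2.2 ha))

theorem tailLaw_real_large_digit_eq (θ : I) {t : ℝ} (ht : 0 < t) :
    (tailLaw θ).real {x | t ≤ digit 0 x} = (1 + θ) / (⌈t⌉₊ + θ) := by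
  have hθ : (0 : ℝ) ≤ θ := θ.2.1
  have h : {x | t ≤ (digit 0 x : ℝ)} = {x | ⌈t⌉₊ ≤ digit 0 x} := by
    ext x; simp only [mem_ofPred_eq, Nat.ceil_le]
  rw [h, measureReal_def, tailLaw_le_digit_zero θ (Nat.ceil_pos.2 ht),
    ENNReal.toReal_ofReal (by positivity)]

theorem tailLaw_real_large_digit_le (θ : I) {t : ℝ} (ht : 0 < t) :
    (tailLaw θ).real {x | t ≤ digit 0 x} ≤ 2 / t := by
  have hθ : (0 : ℝ) ≤ θ := θ.2.1
  have hθ1 : (θ : ℝ) ≤ 1 := θ.2.2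
  have h := Nat.le_ceil t
  rw [tailLaw_real_large_digit_eq θ ht, div_le_div_iff₀ (by positivity) ht]
  nlinarith

theorem le_tailLaw_real_large_digit (θ : I) {t : ℝ} (ht : 1 ≤ t) :
    1 / (2 * t) ≤ (tailLaw θ).real {x | t ≤ digit 0 x} := by
  have hθ : (0 : ℝ) ≤ θ := θ.2.1
  have h := Nat.ceil_lt_add_one (zero_le_one.trans ht)
  have hc : (0 : ℝ) < ⌈t⌉₊ := by exact_mod_cast Nat.ceil_pos.2 (zero_lt_one.trans_le ht)
  rw [tailLaw_real_large_digit_eq θ (by linarith),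
    div_le_div_iff₀ (by positivity) (by positivity)]
  nlinarith

theorem measurableSet_large_digit (t : ℝ) : MeasurableSet {x | t ≤ (digit 0 x : ℝ)} :=
  measurable_digit 0 (MeasurableSet.of_discrete (s := {n : ℕ | t ≤ (n : ℝ)}))

/-- The event that the product of the first two partial quotients is at least `t`. -/
def largeProduct (t : ℝ) : Set ℝ := {x | t ≤ (digit 0 x : ℝ) * digit 1 x}

theorem measurableSet_largeProduct (t : ℝ) : MeasurableSet (largeProduct t) :=
  ((measurable_digit 0).prodMk (measurable_digit 1))
    (MeasurableSet.of_discrete (s := {p : ℕ × ℕ | t ≤ (p.1 : ℝ) * p.2}))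

theorem determinedBy_largeProduct (t : ℝ) : DeterminedBy 2 (largeProduct t) :=
  determinedBy_setOf_digit_digit fun m n => t ≤ (m : ℝ) * n

theorem iterate_mem_largeProduct {t x : ℝ} {n : ℕ} :
    gaussMap^[n] x ∈ largeProduct t ↔ t ≤ (digit n x : ℝ) * digit (n + 1) x := by
  rw [largeProduct, mem_ofPred_eq, ← digit_add, ← digit_add, zero_add, add_comm 1 n]

theorem sum_inv_succ_eq_harmonic (n : ℕ) :
    ∑ i ∈ Finset.range n, 1 / ((i + 1 : ℕ) : ℝ) = harmonic n := by
  simp [harmonic]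

/-- The events `a_1 = b, a_2 ≥ t / b` with `b ≤ t` have probability of order `1 / (b t)`; summing
the harmonic series produces the logarithm. -/
theorem le_tailLaw_real_largeProduct (θ : I) {t : ℝ} (ht : 1 ≤ t) :
    Real.log t / (6 * t) ≤ (tailLaw θ).real (largeProduct t) := by
  have ht0 : 0 < t := zero_lt_one.trans_le ht
  set f : ℕ → Set ℝ := fun i => {x | digit 0 x = i + 1} ∩
    gaussMap ⁻¹' {x | t / ((i + 1 : ℕ) : ℝ) ≤ digit 0 x} with hf
  have hfm : ∀ i, MeasurableSet (f i) := fun i =>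
    (measurable_digit 0 (measurableSet_singleton _)).inter
      (measurable_gaussMap (measurableSet_large_digit _))
  have hsub : (⋃ i ∈ Finset.range ⌊t⌋₊, f i) ⊆ largeProduct t := by
    intro x hx
    simp only [mem_iUnion] at hx
    obtain ⟨i, _, h1, h2⟩ := hx
    have h1 : digit 0 x = i + 1 := h1
    have h2 : t / ((i + 1 : ℕ) : ℝ) ≤ digit 1 x := h2
    rw [div_le_iff₀' (by positivity)] at h2
    rwa [largeProduct, mem_ofPred_eq, h1]
  have hdisj : (↑(Finset.range ⌊t⌋₊) : Set ℕ).PairwiseDisjoint f := by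
    intro i _ j _ hij
    refine Set.disjoint_left.2 ?_
    rintro x ⟨h1, _⟩ ⟨h2, _⟩
    have h1 : digit 0 x = i + 1 := h1
    have h2 : digit 0 x = j + 1 := h2
    omega
  have hterm : ∀ i ∈ Finset.range ⌊t⌋₊,
      1 / (6 * t) * (1 / ((i + 1 : ℕ) : ℝ)) ≤ (tailLaw θ).real (f i) := by
    intro i hi
    have hi1 : ((i + 1 : ℕ) : ℝ) ≤ t :=
      (Nat.le_floor_iff ht0.le).1 (Finset.mem_range.1 hi)
    have hi0 : (0 : ℝ) < ((i + 1 : ℕ) : ℝ) := by positivity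
    obtain ⟨θ', h⟩ := exists_tailLaw_digit_inter θ (a := i + 1) (by omega)
    have h' := h _ (measurableSet_large_digit (t / ((i + 1 : ℕ) : ℝ)))
    have h1 := le_digitProb θ.2.1 θ.2.2 (a := i + 1) (by omega)
    have h2 := le_tailLaw_real_large_digit θ' ((one_le_div hi0).2 hi1)
    rw [measureReal_def, hf, h', ENNReal.toReal_mul,
      ENNReal.toReal_ofReal (le_trans (by positivity) h1)]
    refine le_trans (le_of_eq ?_) (mul_le_mul h1 h2 (by positivity) (le_trans (by positivity) h1))
    field_simp
    norm_num
  have hlog : Real.log t ≤ harmonic ⌊t⌋₊ := by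
    refine le_trans (Real.log_le_log ht0 ?_) (log_add_one_le_harmonic _)
    push_cast
    exact (Nat.lt_floor_add_one t).le
  calc Real.log t / (6 * t) = 1 / (6 * t) * Real.log t := by ring
    _ ≤ 1 / (6 * t) * harmonic ⌊t⌋₊ := by gcongr
    _ = ∑ i ∈ Finset.range ⌊t⌋₊, 1 / (6 * t) * (1 / ((i + 1 : ℕ) : ℝ)) := by
      rw [← Finset.mul_sum, sum_inv_succ_eq_harmonic]
    _ ≤ ∑ i ∈ Finset.range ⌊t⌋₊, (tailLaw θ).real (f i) := Finset.sum_le_sum hterm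
    _ = (tailLaw θ).real (⋃ i ∈ Finset.range ⌊t⌋₊, f i) :=
      (measureReal_biUnion_finset hdisj fun i _ => hfm i).symm
    _ ≤ (tailLaw θ).real (largeProduct t) := measureReal_mono hsub

theorem tailLaw_real_largeProduct_le (θ : I) {t : ℝ} (ht : Real.exp 1 ≤ t) :
    (tailLaw θ).real (largeProduct t) ≤ 10 * (Real.log t / t) := by
  have ht0 : 0 < t := (Real.exp_pos 1).trans_le ht
  have hlog1 : 1 ≤ Real.log t := (Real.le_log_iff_exp_le ht0).2 ht
  set f : ℕ → Set ℝ := fun i => {x | digit 0 x = i + 1} ∩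
    gaussMap^[1] ⁻¹' {x | t / ((i + 1 : ℕ) : ℝ) ≤ digit 0 x} with hf
  have hsub : ∀ x ∈ irrationalUnit, x ∈ largeProduct t →
      x ∈ {x | t ≤ (digit 0 x : ℝ)} ∪ ⋃ i ∈ Finset.range ⌊t⌋₊, f i := by
    intro x hx hxt
    have hxt : t ≤ (digit 0 x : ℝ) * digit 1 x := hxt
    rcases le_or_gt t (digit 0 x) with h | h
    · exact Or.inl h
    · right
      have h1 := one_le_digit hx 0
      have h2 : digit 0 x ≤ ⌊t⌋₊ := Nat.le_floor h.le
      simp only [mem_iUnion]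
      refine ⟨digit 0 x - 1, Finset.mem_range.2 (by omega), ?_, ?_⟩
      · simp only [mem_ofPred_eq]; omega
      · change t / ((digit 0 x - 1 + 1 : ℕ) : ℝ) ≤ digit 1 x
        rw [Nat.sub_add_cancel h1, div_le_iff₀' (by exact_mod_cast h1)]
        exact hxt
  have hterm : ∀ i ∈ Finset.range ⌊t⌋₊,
      (tailLaw θ).real (f i) ≤ 4 / t * (1 / ((i + 1 : ℕ) : ℝ)) := by
    intro i _
    have hi0 : (0 : ℝ) < ((i + 1 : ℕ) : ℝ) := by positivity
    refine (tailLaw_real_inter_preimage_le (determinedBy_setOf_digit (· = i + 1))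
      (measurable_digit 0 (measurableSet_singleton _)) (measurableSet_large_digit _)
      (fun θ => tailLaw_real_large_digit_le θ (div_pos ht0 hi0)) θ).trans ?_
    refine (mul_le_mul_of_nonneg_left (tailLaw_real_digit_eq_le θ (a := i + 1) (by omega))
      (by positivity)).trans (le_of_eq ?_)
    field_simp
    norm_num
  have hharm : (harmonic ⌊t⌋₊ : ℝ) ≤ 1 + Real.log t := by
    refine (harmonic_le_one_add_log _).trans ?_
    have h1 : 1 ≤ ⌊t⌋₊ := Nat.le_floor (by
      have := Real.add_one_le_exp (1 : ℝ); push_cast; linarith)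
    gcongr
    exact Nat.floor_le ht0.le
  calc (tailLaw θ).real (largeProduct t)
      ≤ (tailLaw θ).real ({x | t ≤ (digit 0 x : ℝ)} ∪ ⋃ i ∈ Finset.range ⌊t⌋₊, f i) :=
        tailLaw_real_mono θ hsub
    _ ≤ (tailLaw θ).real {x | t ≤ (digit 0 x : ℝ)} +
        ∑ i ∈ Finset.range ⌊t⌋₊, (tailLaw θ).real (f i) :=
        (measureReal_union_le _ _).trans
          (add_le_add_right (measureReal_biUnion_finset_le _ _) _)
    _ ≤ 2 / t + ∑ i ∈ Finset.range ⌊t⌋₊, 4 / t * (1 / ((i + 1 : ℕ) : ℝ)) :=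
        add_le_add (tailLaw_real_large_digit_le θ ht0) (Finset.sum_le_sum hterm)
    _ = (2 + 4 * harmonic ⌊t⌋₊) / t := by
        rw [← Finset.mul_sum, sum_inv_succ_eq_harmonic]; ring
    _ ≤ (10 * Real.log t) / t := by gcongr; linarith
    _ = 10 * (Real.log t / t) := by ring

/-- Two overlapping large products cost only `O(1 / t)`: the cheapest way to produce them is a
common partial quotient of size `t`. -/
theorem tailLaw_real_largeProduct_inter_le (θ : I) {t : ℝ} (ht : 0 < t) :
    (tailLaw θ).real (largeProduct t ∩ gaussMap ⁻¹' largeProduct t) ≤ 10 / t := by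
  set A : ℕ → Set ℝ := fun i => {x | t / ((i + 1 : ℕ) : ℝ) ≤ digit 0 x} ∩
    gaussMap^[1] ⁻¹' {x | digit 0 x = i + 1} with hA
  set f : ℕ → Set ℝ := fun i => A i ∩
    gaussMap^[2] ⁻¹' {x | t / ((i + 1 : ℕ) : ℝ) ≤ digit 0 x} with hf
  have hsub : ∀ x ∈ irrationalUnit, x ∈ largeProduct t ∩ gaussMap ⁻¹' largeProduct t →
      x ∈ gaussMap^[1] ⁻¹' {x | t ≤ (digit 0 x : ℝ)} ∪ ⋃ i ∈ Finset.range ⌊t⌋₊, f i := by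
    rintro x hx ⟨hx1, hx2⟩
    have hx1 : t ≤ (digit 0 x : ℝ) * digit 1 x := hx1
    have hx2 : t ≤ (digit 1 x : ℝ) * digit 2 x := hx2
    rcases le_or_gt t (digit 1 x) with h | h
    · exact Or.inl h
    · right
      have h1 := one_le_digit hx 1
      have h2 : digit 1 x ≤ ⌊t⌋₊ := Nat.le_floor h.le
      have h3 : (0 : ℝ) < digit 1 x := by exact_mod_cast h1
      simp only [mem_iUnion]
      refine ⟨digit 1 x - 1, Finset.mem_range.2 (by omega), ⟨?_, ?_⟩, ?_⟩
      · simp only [mem_ofPred_eq]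
        rw [Nat.sub_add_cancel h1, div_le_iff₀ h3]
        exact hx1
      · change digit 1 x = digit 1 x - 1 + 1
        omega
      · change t / ((digit 1 x - 1 + 1 : ℕ) : ℝ) ≤ digit 2 x
        rw [Nat.sub_add_cancel h1, div_le_iff₀' h3]
        exact hx2
  have hAd : ∀ i, DeterminedBy 2 (A i) := fun i =>
    ((determinedBy_setOf_digit fun n : ℕ => t / ((i + 1 : ℕ) : ℝ) ≤ n).mono one_le_two).inter
      ((determinedBy_setOf_digit (· = i + 1)).preimage 1)
  have hAm : ∀ i, MeasurableSet (A i) := fun i => (measurableSet_large_digit _).inter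
    (measurable_gaussMap.iterate 1 (measurable_digit 0 (measurableSet_singleton _)))
  have hterm : ∀ i ∈ Finset.range ⌊t⌋₊, (tailLaw θ).real (f i) ≤ 8 / t ^ 2 := by
    intro i _
    have hi0 : (0 : ℝ) < ((i + 1 : ℕ) : ℝ) := by positivity
    have hlarge : ∀ θ, (tailLaw θ).real {x | t / ((i + 1 : ℕ) : ℝ) ≤ digit 0 x} ≤
        2 / (t / ((i + 1 : ℕ) : ℝ)) :=
      fun θ => tailLaw_real_large_digit_le θ (div_pos ht hi0)
    have h1 : (tailLaw θ).real (A i) ≤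
        2 / ((i + 1 : ℕ) : ℝ) ^ 2 * (2 / (t / ((i + 1 : ℕ) : ℝ))) :=
      (tailLaw_real_inter_preimage_le
        (determinedBy_setOf_digit fun n : ℕ => t / ((i + 1 : ℕ) : ℝ) ≤ n)
        (measurableSet_large_digit _) (measurable_digit 0 (measurableSet_singleton _))
        (fun θ => tailLaw_real_digit_eq_le θ (a := i + 1) (by omega)) θ).trans
        (mul_le_mul_of_nonneg_left (hlarge θ) (by positivity))
    refine (tailLaw_real_inter_preimage_le (hAd i) (hAm i) (measurableSet_large_digit _)
      hlarge θ).trans ?_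
    refine (mul_le_mul_of_nonneg_left h1 (by positivity)).trans (le_of_eq ?_)
    field_simp
    norm_num
  calc (tailLaw θ).real (largeProduct t ∩ gaussMap ⁻¹' largeProduct t)
      ≤ (tailLaw θ).real (gaussMap^[1] ⁻¹' {x | t ≤ (digit 0 x : ℝ)} ∪
          ⋃ i ∈ Finset.range ⌊t⌋₊, f i) := tailLaw_real_mono θ hsub
    _ ≤ (tailLaw θ).real (gaussMap^[1] ⁻¹' {x | t ≤ (digit 0 x : ℝ)}) +
        ∑ i ∈ Finset.range ⌊t⌋₊, (tailLaw θ).real (f i) :=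
        (measureReal_union_le _ _).trans
          (add_le_add_right (measureReal_biUnion_finset_le _ _) _)
    _ ≤ 2 / t + ∑ i ∈ Finset.range ⌊t⌋₊, 8 / t ^ 2 :=
        add_le_add (tailLaw_real_preimage_le 1 (measurableSet_large_digit t)
          (fun θ => tailLaw_real_large_digit_le θ ht) θ) (Finset.sum_le_sum hterm)
    _ = 2 / t + ⌊t⌋₊ * (8 / t ^ 2) := by
        rw [Finset.sum_const, Finset.card_range, nsmul_eq_mul]
    _ ≤ 2 / t + t * (8 / t ^ 2) := by
        have := Nat.floor_le ht.le
        gcongr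
    _ = 10 / t := by field_simp; norm_num

/-! ### The convergence case -/

theorem measurableSet_iterate_largeProduct (n : ℕ) (t : ℝ) :
    MeasurableSet (gaussMap^[n] ⁻¹' largeProduct t) :=
  measurable_gaussMap.iterate n (measurableSet_largeProduct t)

/-- The case `k = m - 1` contributes `O(1 / φ)`; every other `k < m` contributes
`O((log φ / φ) ^ 2)`, since the two products then involve disjoint sets of partial quotients. -/
theorem tailLaw_real_two_products_le (θ : I) {φ : ℕ → ℝ} {m : ℕ}
    (ht : Real.exp 1 ≤ φ (m + 1)) :
    (tailLaw θ).real {x | gaussMap^[m] x ∈ largeProduct (φ (m + 1)) ∧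
      ∃ k < m, gaussMap^[k] x ∈ largeProduct (φ (m + 1))} ≤ 100 * seriesTerm φ (m + 1) := by
  set t := φ (m + 1) with htdef
  have ht0 : 0 < t := (Real.exp_pos 1).trans_le ht
  have hlog1 : 1 ≤ Real.log t := (Real.le_log_iff_exp_le ht0).2 ht
  have hseries : seriesTerm φ (m + 1) = 1 / t + (m + 1) * (Real.log t / t) ^ 2 := by
    rw [seriesTerm, ← htdef]; push_cast; field_simp
  have hs0 : 0 ≤ seriesTerm φ (m + 1) := by rw [hseries]; positivity
  rcases m with _ | m
  · simpa using hs0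
  set f : ℕ → Set ℝ := fun k => gaussMap^[k] ⁻¹' largeProduct t ∩
    gaussMap^[m + 1] ⁻¹' largeProduct t with hf
  have hsub : {x | gaussMap^[m + 1] x ∈ largeProduct t ∧
      ∃ k < m + 1, gaussMap^[k] x ∈ largeProduct t} ⊆
      gaussMap^[m] ⁻¹' (largeProduct t ∩ gaussMap ⁻¹' largeProduct t) ∪
        ⋃ k ∈ Finset.range m, f k := by
    rintro x ⟨hx, k, hk, hxk⟩
    rcases Nat.lt_succ_iff_lt_or_eq.1 hk with hk | rfl
    · right
      simp only [mem_iUnion]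
      exact ⟨k, Finset.mem_range.2 hk, hxk, hx⟩
    · left
      rw [Function.iterate_succ_apply'] at hx
      exact ⟨hxk, hx⟩
  have hterm : ∀ k ∈ Finset.range m,
      (tailLaw θ).real (f k) ≤ (10 * (Real.log t / t)) * (10 * (Real.log t / t)) := by
    intro k hk
    have hk := Finset.mem_range.1 hk
    refine (tailLaw_real_inter_preimage_le
      (((determinedBy_largeProduct t).preimage k).mono (by omega))
      (measurableSet_iterate_largeProduct k t) (measurableSet_largeProduct t)
      (fun θ => tailLaw_real_largeProduct_le θ ht) θ).trans ?_
    exact mul_le_mul_of_nonneg_left (tailLaw_real_preimage_le k (measurableSet_largeProduct t)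
      (fun θ => tailLaw_real_largeProduct_le θ ht) θ) (by positivity)
  calc _ ≤ (tailLaw θ).real (gaussMap^[m] ⁻¹' (largeProduct t ∩ gaussMap ⁻¹' largeProduct t) ∪
        ⋃ k ∈ Finset.range m, f k) := measureReal_mono hsub
    _ ≤ (tailLaw θ).real (gaussMap^[m] ⁻¹' (largeProduct t ∩ gaussMap ⁻¹' largeProduct t)) +
        ∑ k ∈ Finset.range m, (tailLaw θ).real (f k) :=
        (measureReal_union_le _ _).trans
          (add_le_add_right (measureReal_biUnion_finset_le _ _) _)
    _ ≤ 10 / t + ∑ k ∈ Finset.range m, (10 * (Real.log t / t)) * (10 * (Real.log t / t)) :=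
        add_le_add (tailLaw_real_preimage_le m ((measurableSet_largeProduct t).inter
          (measurable_gaussMap (measurableSet_largeProduct t)))
          (fun θ => tailLaw_real_largeProduct_inter_le θ ht0) θ) (Finset.sum_le_sum hterm)
    _ = 10 * (1 / t) + 100 * (m * (Real.log t / t) ^ 2) := by
        rw [Finset.sum_const, Finset.card_range, nsmul_eq_mul]; ring
    _ ≤ 100 * (1 / t) + 100 * ((m + 1 + 1) * (Real.log t / t) ^ 2) := by
        gcongr
        · norm_num
        · linarith
    _ = 100 * seriesTerm φ (m + 1 + 1) := by rw [hseries]; push_cast; ring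

theorem seriesTerm_eq {φ : ℕ → ℝ} {n : ℕ} (h : 0 < φ n) :
    seriesTerm φ n = 1 / φ n + n * (Real.log (φ n) / φ n) ^ 2 := by
  rw [seriesTerm]; field_simp

theorem tendsto_atTop_of_summable_seriesTerm {φ : ℕ → ℝ} (hpos : ∀ n : ℕ, 1 ≤ n → 0 < φ n)
    (hs : Summable fun n : ℕ => seriesTerm φ (n + 1)) :
    Tendsto (fun n : ℕ => φ (n + 1)) atTop atTop := by
  have h : Summable fun n : ℕ => (φ (n + 1))⁻¹ := by
    refine hs.of_nonneg_of_le (fun n => (inv_pos.2 (hpos _ (by omega))).le) fun n => ?_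
    rw [seriesTerm_eq (hpos _ (by omega)), one_div]
    have : 0 ≤ ((n + 1 : ℕ) : ℝ) * (Real.log (φ (n + 1)) / φ (n + 1)) ^ 2 := by positivity
    linarith
  have h0 : Tendsto (fun n : ℕ => (φ (n + 1))⁻¹) atTop (𝓝[>] 0) :=
    tendsto_nhdsWithin_iff.2 ⟨h.tendsto_atTop_zero,
      Eventually.of_forall fun n => inv_pos.2 (hpos _ (by omega))⟩
  simpa [Pi.inv_def] using h0.inv_tendsto_nhdsGT_zero

/-- If `φ` tends to infinity, then infinitely many occurrences of two large products force
infinitely many occurrences in which the later product sits at the index where the threshold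
is read off. -/
theorem frequently_of_mem_largeProductsSet {φ : ℕ → ℝ} (hmono : MonotoneOn φ (Ici 1))
    (htop : Tendsto (fun n : ℕ => φ (n + 1)) atTop atTop) {x : ℝ}
    (hx : x ∈ largeProductsSet φ) :
    ∃ᶠ m in atTop, gaussMap^[m] x ∈ largeProduct (φ (m + 1)) ∧
      ∃ k < m, gaussMap^[k] x ∈ largeProduct (φ (m + 1)) := by
  rw [frequently_atTop]
  intro M
  -- once `φ n` exceeds every product at an index below `M`, both witnesses lie beyond `M`
  have hev : ∀ᶠ n in atTop, ∀ i ∈ Finset.range M,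
      (digit i x : ℝ) * digit (i + 1) x < φ (n + 1) :=
    (Finset.range M).eventually_all.2 fun i _ => htop.eventually_gt_atTop _
  obtain ⟨n₀, hn₀⟩ := eventually_atTop.1 hev
  obtain ⟨n, ⟨k, l, hk1, hkn, hl1, hln, hkl, hk, hl⟩, hn⟩ := hx.2.exists_gt (n₀ + 1)
  obtain ⟨n, rfl⟩ : ∃ n', n = n' + 1 := ⟨n - 1, by omega⟩
  obtain ⟨k, rfl⟩ : ∃ n', k = n' + 1 := ⟨k - 1, by omega⟩
  obtain ⟨l, rfl⟩ : ∃ n', l = n' + 1 := ⟨l - 1, by omega⟩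
  simp only [partialQuotient_succ] at hk hl
  have hbig : ∀ i, φ (n + 1) ≤ (digit i x : ℝ) * digit (i + 1) x → M ≤ i := fun i hi => by
    by_contra hlt
    exact (hn₀ n (by omega) i (Finset.mem_range.2 (by omega))).not_ge hi
  have hφ : ∀ i ≤ n, φ (i + 1) ≤ φ (n + 1) := fun i hi =>
    hmono (mem_Ici.2 (by omega)) (mem_Ici.2 (by omega)) (by omega)
  rcases lt_or_gt_of_ne hkl with h | h
  · refine ⟨l, hbig l hl, ?_, k, by omega, ?_⟩ <;> rw [iterate_mem_largeProduct]
    · exact (hφ l (by omega)).trans hl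
    · exact (hφ l (by omega)).trans hk
  · refine ⟨k, hbig k hk, ?_, l, by omega, ?_⟩ <;> rw [iterate_mem_largeProduct]
    · exact (hφ k (by omega)).trans hk
    · exact (hφ k (by omega)).trans hl

theorem ae_notMem_largeProductsSet {φ : ℕ → ℝ} (hpos : ∀ n : ℕ, 1 ≤ n → 0 < φ n)
    (hmono : MonotoneOn φ (Ici 1)) (hs : Summable fun n : ℕ => seriesTerm φ (n + 1)) (θ : I) :
    ∀ᵐ x ∂tailLaw θ, x ∉ largeProductsSet φ := by
  have htop := tendsto_atTop_of_summable_seriesTerm hpos hs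
  have hsum : Summable fun m : ℕ => (tailLaw θ).real
      {x | gaussMap^[m] x ∈ largeProduct (φ (m + 1)) ∧
        ∃ k < m, gaussMap^[k] x ∈ largeProduct (φ (m + 1))} := by
    refine Summable.of_norm_bounded_eventually_nat (hs.mul_left 100) ?_
    filter_upwards [htop.eventually_ge_atTop (Real.exp 1)] with m hm
    rw [Real.norm_of_nonneg measureReal_nonneg]
    exact tailLaw_real_two_products_le θ hm
  have hne := hsum.tsum_ofReal_ne_top
  rw [tsum_congr fun m => ofReal_measureReal] at hne
  have h0 := measure_setOfPred_frequently_eq_zero hne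
  filter_upwards [measure_eq_zero_iff_ae_notMem.1 h0] with x hx hmem
  exact hx (frequently_of_mem_largeProductsSet hmono htop hmem)

/-! ### The divergence case -/

theorem mem_largeProductsSet_of_frequently {φ : ℕ → ℝ} {x : ℝ} (hx : x ∈ irrationalUnit)
    (h : ∃ᶠ n in atTop, ∃ k l : ℕ, k < l ∧ l < n ∧
      gaussMap^[k] x ∈ largeProduct (φ n) ∧ gaussMap^[l] x ∈ largeProduct (φ n)) :
    x ∈ largeProductsSet φ := by
  refine ⟨⟨hx.1.1.le, hx.1.2⟩, Nat.frequently_atTop_iff_infinite.1 (h.mono ?_)⟩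
  rintro n ⟨k, l, hkl, hln, hk, hl⟩
  rw [iterate_mem_largeProduct] at hk hl
  exact ⟨k + 1, l + 1, by omega, by omega, by omega, by omega, by omega, hk, hl⟩

/-- A single partial quotient `a_n ≥ φ n` makes both products containing it large, so if
`∑ 1 / φ n` diverges, the Borel–Bernstein argument suffices. -/
theorem ae_mem_largeProductsSet_of_not_summable_inv {φ : ℕ → ℝ} (hφ : ∀ n, 1 ≤ φ n)
    (hs : ¬ Summable fun n : ℕ => 1 / φ (n + 1)) (θ : I) :
    ∀ᵐ x ∂tailLaw θ, x ∈ largeProductsSet φ := by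
  have hs' : ¬ Summable fun n : ℕ => 1 / (2 * φ (n + 1)) := fun h => hs (by
    refine (h.mul_left 2).congr fun n => ?_
    have := hφ (n + 1)
    field_simp)
  have h := ae_frequently_mem_preimage (N := fun j => j) (L := fun _ => 1) (fun _ => rfl)
    (C := fun j => {x | φ (j + 1) ≤ digit 0 x})
    (fun j => determinedBy_setOf_digit fun n : ℕ => φ (j + 1) ≤ n)
    (fun j => measurableSet_large_digit _)
    (fun j θ => le_tailLaw_real_large_digit θ (hφ (j + 1)))
    (fun j => by have := hφ (j + 1); positivity) hs' θ
  filter_upwards [h, ae_mem_irrationalUnit θ] with x hx hxm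
  have ht : Tendsto (fun j : ℕ => j + 1) atTop atTop := tendsto_add_atTop_nat 1
  refine mem_largeProductsSet_of_frequently hxm (ht.frequently
    ((hx.and_eventually (eventually_ge_atTop 1)).mono ?_))
  rintro j ⟨hj, hj1⟩
  have hj : φ (j + 1) ≤ digit 0 (gaussMap^[j] x) := hj
  rw [← digit_add, zero_add] at hj
  have h1 : ∀ i, (1 : ℝ) ≤ digit i x := fun i => by exact_mod_cast one_le_digit hxm i
  refine ⟨j - 1, j, by omega, by omega, ?_, ?_⟩ <;> rw [iterate_mem_largeProduct]
  · rw [Nat.sub_add_cancel hj1]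
    nlinarith [h1 (j - 1), h1 j]
  · nlinarith [h1 (j + 1), h1 j]

/-- The event that one of the `M` disjoint products `a_1 a_2, a_3 a_4, …, a_{2M-1} a_{2M}` is at
least `t`. -/
def someLargeProduct (t : ℝ) (M : ℕ) : Set ℝ :=
  (avoidSet (fun j => 2 * j) (fun _ => largeProduct t) 0 M)ᶜ

theorem exists_of_mem_someLargeProduct {t : ℝ} {M : ℕ} {x : ℝ} (hx : x ∈ someLargeProduct t M) :
    ∃ s < M, gaussMap^[2 * s] x ∈ largeProduct t := by
  by_contra! h
  refine hx ?_
  clear hx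
  induction M with
  | zero => trivial
  | succ M ih =>
    refine ⟨ih fun s hs => h s (by omega), ?_⟩
    rw [zero_add]
    exact h M (by omega)

theorem measurableSet_someLargeProduct (t : ℝ) (M : ℕ) :
    MeasurableSet (someLargeProduct t M) :=
  (measurableSet_avoidSet (fun _ => measurableSet_largeProduct t) 0 M).compl

theorem determinedBy_someLargeProduct (t : ℝ) (M : ℕ) :
    DeterminedBy (2 * M) (someLargeProduct t M) := by
  have := determinedBy_avoidSet (N := fun j => 2 * j) (L := fun _ => 2) (fun j => by ring)
    (fun _ => determinedBy_largeProduct t) 0 M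
  rw [zero_add] at this
  exact this.compl

theorem tailLaw_real_compl_someLargeProduct_le (θ : I) {t : ℝ} (ht : 1 ≤ t) (M : ℕ) :
    (tailLaw θ).real (someLargeProduct t M)ᶜ ≤
      1 - M * (Real.log t / (6 * t)) / (1 + M * (Real.log t / (6 * t))) := by
  have hlog := Real.log_nonneg ht
  have h := tailLaw_avoidSet_le (N := fun j => 2 * j) (L := fun _ => 2) (fun j => by ring)
    (fun _ => determinedBy_largeProduct t) (fun _ => measurableSet_largeProduct t)
    (q := fun _ => Real.log t / (6 * t)) (fun _ θ => le_tailLaw_real_largeProduct θ ht) 0 M θ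
  rw [someLargeProduct, compl_compl]
  refine h.trans ?_
  rw [Finset.sum_const, Finset.card_range, nsmul_eq_mul]
  set y := (M : ℝ) * (Real.log t / (6 * t)) with hy
  have hy0 : 0 ≤ y := by positivity
  have h1 : 1 - y / (1 + y) = 1 / (1 + y) := by field_simp; ring
  rw [h1, Real.exp_neg, ← one_div]
  have := Real.add_one_le_exp y
  exact one_div_le_one_div_of_le (by positivity) (by linarith)

theorem le_tailLaw_real_someLargeProduct_twice (θ : I) {t : ℝ} (ht : 1 ≤ t) (M : ℕ) :
    (M * (Real.log t / (6 * t)) / (1 + M * (Real.log t / (6 * t)))) ^ 2 ≤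
      (tailLaw θ).real (someLargeProduct t M ∩
        gaussMap^[2 * M] ⁻¹' someLargeProduct t M) := by
  have hlog := Real.log_nonneg ht
  have hm := measurableSet_someLargeProduct t M
  set h := M * (Real.log t / (6 * t)) / (1 + M * (Real.log t / (6 * t))) with hh
  have hh0 : 0 ≤ h := by positivity
  have hc : ∀ θ, (tailLaw θ).real (someLargeProduct t M)ᶜ ≤ 1 - h :=
    fun θ => tailLaw_real_compl_someLargeProduct_le θ ht M
  have h1 := tailLaw_real_inter_preimage_le (determinedBy_someLargeProduct t M) hm hm.compl hc θ
  have h2 : h ≤ (tailLaw θ).real (someLargeProduct t M) := by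
    have := hc θ
    rw [probReal_compl_eq_one_sub hm] at this
    linarith
  have h3 := measureReal_inter_add_sdiff (μ := tailLaw θ) (s := someLargeProduct t M)
    (measurable_gaussMap.iterate (2 * M) hm)
  rw [sdiff_eq, ← preimage_compl] at h3
  nlinarith

/-- Cauchy condensation for series `∑ n g n` with `g` non-increasing. -/
theorem summable_mul_of_condensed {g : ℕ → ℝ} (h0 : ∀ n, 0 ≤ g n)
    (hg : AntitoneOn g (Ici 1)) (hs : Summable fun j : ℕ => (4 : ℝ) ^ j * g (2 ^ j)) :
    Summable fun n : ℕ => ((n + 1 : ℕ) : ℝ) * g (n + 1) := by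
  have hblock : ∀ K : ℕ, ∑ n ∈ Finset.Ico (1 : ℕ) (2 ^ K), (n : ℝ) * g n ≤
      ∑ j ∈ Finset.range K, 2 * ((4 : ℝ) ^ j * g (2 ^ j)) := by
    intro K
    induction K with
    | zero => simp
    | succ K ih =>
      rw [Finset.sum_range_succ, ← Finset.sum_Ico_consecutive _ (Nat.one_le_two_pow (n := K))
        (Nat.pow_le_pow_right two_pos (Nat.le_succ K))]
      refine add_le_add ih ?_
      have hle : ∀ n ∈ Finset.Ico (2 ^ K : ℕ) (2 ^ (K + 1)),
          (n : ℝ) * g n ≤ 2 ^ (K + 1) * g (2 ^ K) := by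
        intro n hn
        obtain ⟨hn1, hn2⟩ := Finset.mem_Ico.1 hn
        have h1 := Nat.one_le_two_pow (n := K)
        have h2 : (n : ℝ) ≤ 2 ^ (K + 1) := by exact_mod_cast hn2.le
        exact mul_le_mul h2 (hg h1 (h1.trans hn1) hn1) (h0 _) (by positivity)
      refine (Finset.sum_le_card_nsmul _ _ _ hle).trans (le_of_eq ?_)
      rw [Nat.card_Ico, nsmul_eq_mul, pow_succ 2 K,
        show 2 ^ K * 2 - 2 ^ K = 2 ^ K by omega, show (4 : ℝ) = 2 * 2 by norm_num, mul_pow]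
      push_cast
      ring
  refine summable_of_sum_range_le (c := ∑' j : ℕ, 2 * ((4 : ℝ) ^ j * g (2 ^ j)))
    (fun n => mul_nonneg (by positivity) (h0 _)) fun n => ?_
  have hn : ∑ i ∈ Finset.range n, ((i + 1 : ℕ) : ℝ) * g (i + 1) =
      ∑ i ∈ Finset.Ico (1 : ℕ) (n + 1), (i : ℝ) * g i := by
    rw [Finset.sum_Ico_eq_sum_range]
    simp [add_comm]
  rw [hn]
  calc _ ≤ ∑ i ∈ Finset.Ico (1 : ℕ) (2 ^ (n + 1)), (i : ℝ) * g i :=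
        Finset.sum_le_sum_of_subset_of_nonneg
          (Finset.Ico_subset_Ico_right Nat.lt_two_pow_self.le)
          fun i _ _ => mul_nonneg (by positivity) (h0 i)
    _ ≤ _ := hblock _
    _ ≤ _ := (hs.mul_left 2).sum_le_tsum _
        fun j _ => mul_nonneg zero_le_two (mul_nonneg (by positivity) (h0 _))

/-- The terms of the given series tend to `0`, so `y j < 1` eventually, where `y j / (1 + y j)` is
comparable to `y j`. -/
theorem summable_sq_of_summable_sq_div {y : ℕ → ℝ} (h0 : ∀ j, 0 ≤ y j)
    (hs : Summable fun j => (y j / (1 + y j)) ^ 2) : Summable fun j => y j ^ 2 := by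
  refine Summable.of_norm_bounded_eventually_nat (hs.mul_left 4) ?_
  have h4 : ∀ᶠ j in atTop, (y j / (1 + y j)) ^ 2 < 1 / 4 :=
    hs.tendsto_atTop_zero.eventually_lt_const (by norm_num)
  filter_upwards [h4] with j hj
  have hy := h0 j
  have h1 : y j / (1 + y j) < 1 / 2 := by
    by_contra! h
    nlinarith
  rw [div_lt_div_iff₀ (by positivity) two_pos] at h1
  have h2 : y j ≤ 2 * (y j / (1 + y j)) := by
    rw [← mul_div_assoc, le_div_iff₀ (by positivity)]
    nlinarith
  rw [Real.norm_of_nonneg (by positivity)]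
  calc y j ^ 2 ≤ (2 * (y j / (1 + y j))) ^ 2 := by gcongr
    _ = 4 * (y j / (1 + y j)) ^ 2 := by ring

/-- If `∑ n (log φ n / φ n) ^ 2` diverges, then in infinitely many dyadic blocks of indices each
half of the block contains a large product. -/
theorem ae_mem_largeProductsSet_of_not_summable_sq {φ : ℕ → ℝ} (hφ : ∀ n, Real.exp 1 ≤ φ n)
    (hmono : MonotoneOn φ (Ici 1))
    (hs : ¬ Summable fun n : ℕ =>
      ((n + 1 : ℕ) : ℝ) * (Real.log (φ (n + 1)) / φ (n + 1)) ^ 2) (θ : I) :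
    ∀ᵐ x ∂tailLaw θ, x ∈ largeProductsSet φ := by
  have hone : ∀ n, 1 ≤ φ n := fun n => (Real.one_le_exp zero_le_one).trans (hφ n)
  have hlog : ∀ n, 0 ≤ Real.log (φ n) / φ n := fun n =>
    div_nonneg (Real.log_nonneg (hone n)) (zero_le_one.trans (hone n))
  set y : ℕ → ℝ := fun j => ((2 ^ j : ℕ) : ℝ) *
    (Real.log (φ (2 ^ (j + 3))) / (6 * φ (2 ^ (j + 3)))) with hy
  have hy0 : ∀ j, 0 ≤ y j := fun j => by
    have h1 := hone (2 ^ (j + 3))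
    have := Real.log_nonneg h1
    positivity
  have hq : ¬ Summable fun j => (y j / (1 + y j)) ^ 2 := by
    intro h
    refine hs (summable_mul_of_condensed (g := fun n => (Real.log (φ n) / φ n) ^ 2)
      (fun n => sq_nonneg _) ?_ ?_)
    · intro m hm n hn hmn
      exact pow_le_pow_left₀ (hlog n)
        (Real.log_div_self_antitoneOn (hφ m) (hφ n) (hmono hm hn hmn)) 2
    · refine (summable_nat_add_iff 3).1
        (((summable_sq_of_summable_sq_div hy0 h).mul_left (64 * 36)).congr fun j => ?_)
      have h1 := hone (2 ^ (j + 3))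
      have h4 : (4 : ℝ) ^ (j + 3) = 64 * ((2 : ℝ) ^ j) ^ 2 := by
        rw [← pow_mul, mul_comm j 2, pow_mul, pow_add]; norm_num; ring
      simp only [hy, h4]
      push_cast
      field_simp
      ring
  -- the block of indices `2 ^ (j + 2), …, 2 ^ (j + 3) - 1` has length `4 M` with `M = 2 ^ j`
  have h := ae_frequently_mem_preimage (N := fun j => 2 ^ (j + 2)) (L := fun j => 2 ^ (j + 2))
    (fun j => by ring)
    (C := fun j => someLargeProduct (φ (2 ^ (j + 3))) (2 ^ j) ∩
      gaussMap^[2 * 2 ^ j] ⁻¹' someLargeProduct (φ (2 ^ (j + 3))) (2 ^ j))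
    (fun j => by
      have h1 := determinedBy_someLargeProduct (φ (2 ^ (j + 3))) (2 ^ j)
      have h2 := h1.preimage (2 * 2 ^ j)
      have h3 : 2 * 2 ^ j + 2 * 2 ^ j = 2 ^ (j + 2) := by ring
      rw [h3] at h2
      exact (h1.mono (by omega)).inter h2)
    (fun j => (measurableSet_someLargeProduct _ _).inter
      (measurable_gaussMap.iterate _ (measurableSet_someLargeProduct _ _)))
    (fun j θ => le_tailLaw_real_someLargeProduct_twice θ (hone _) (2 ^ j))
    (fun j => sq_nonneg _) hq θ
  filter_upwards [h, ae_mem_irrationalUnit θ] with x hx hxm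
  have ht : Tendsto (fun j : ℕ => 2 ^ (j + 3)) atTop atTop :=
    (tendsto_pow_atTop_atTop_of_one_lt one_lt_two).comp (tendsto_add_atTop_nat 3)
  refine mem_largeProductsSet_of_frequently hxm (ht.frequently (hx.mono ?_))
  rintro j ⟨h1, h2⟩
  obtain ⟨s, hs, h1⟩ := exists_of_mem_someLargeProduct h1
  obtain ⟨r, hr, h2⟩ := exists_of_mem_someLargeProduct h2
  rw [← Function.iterate_add_apply] at h1
  rw [← Function.iterate_add_apply, ← Function.iterate_add_apply] at h2
  have h3 : 2 ^ (j + 2) = 4 * 2 ^ j := by ring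
  have h4 : 2 ^ (j + 3) = 8 * 2 ^ j := by ring
  exact ⟨_, _, by omega, by omega, h1, h2⟩

theorem largeProductsSet_antitone {φ ψ : ℕ → ℝ} (h : ∀ n, φ n ≤ ψ n) :
    largeProductsSet ψ ⊆ largeProductsSet φ := by
  rintro x ⟨hx, hinf⟩
  refine ⟨hx, hinf.mono ?_⟩
  rintro n ⟨k, l, h1, h2, h3, h4, h5, h6, h7⟩
  exact ⟨k, l, h1, h2, h3, h4, h5, (h n).trans h6, (h n).trans h7⟩

/-- Replacing `φ` by `max φ e` does not affect the divergence of the series. -/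
theorem not_summable_seriesTerm_max {φ : ℕ → ℝ}
    (hs : ¬ Summable fun n : ℕ => seriesTerm φ (n + 1)) :
    ¬ Summable fun n : ℕ => seriesTerm (fun n => max (φ n) (Real.exp 1)) (n + 1) := by
  intro h
  have htop := tendsto_atTop_of_summable_seriesTerm
    (fun n _ => lt_max_of_lt_right (Real.exp_pos 1)) h
  refine hs (h.congr_atTop ?_)
  filter_upwards [htop.eventually_gt_atTop (Real.exp 1)] with n hn
  have hn : Real.exp 1 < φ (n + 1) := by simpa using hn
  simp only [seriesTerm, max_eq_left hn.le]

theorem ae_mem_largeProductsSet {φ : ℕ → ℝ} (hmono : MonotoneOn φ (Ici 1))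
    (hs : ¬ Summable fun n : ℕ => seriesTerm φ (n + 1)) (θ : I) :
    ∀ᵐ x ∂tailLaw θ, x ∈ largeProductsSet φ := by
  set ψ : ℕ → ℝ := fun n => max (φ n) (Real.exp 1) with hψ
  have hψe : ∀ n, Real.exp 1 ≤ ψ n := fun n => le_max_right _ _
  have hψ1 : ∀ n, 1 ≤ ψ n := fun n => (Real.one_le_exp zero_le_one).trans (hψe n)
  have hψm : MonotoneOn ψ (Ici 1) := fun m hm n hn hmn =>
    max_le_max_right _ (hmono hm hn hmn)
  have hdiv := not_summable_seriesTerm_max hs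
  have hae : ∀ᵐ x ∂tailLaw θ, x ∈ largeProductsSet ψ := by
    by_cases h1 : Summable fun n : ℕ => 1 / ψ (n + 1)
    · refine ae_mem_largeProductsSet_of_not_summable_sq hψe hψm (fun h2 => hdiv ?_) θ
      exact (h1.add h2).congr fun n =>
        (seriesTerm_eq (zero_lt_one.trans_le (hψ1 (n + 1)))).symm
    · exact ae_mem_largeProductsSet_of_not_summable_inv hψ1 h1 θ
  filter_upwards [hae] with x hx
  exact largeProductsSet_antitone (fun n => le_max_left _ _) hx

/-! ### The measure of the set -/

theorem theorem1p4 (φ : ℕ → ℝ) (hpos : ∀ n : ℕ, 1 ≤ n → 0 < φ n)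
    (hmono : MonotoneOn φ (Set.Ici 1)) :
    (Summable (fun n : ℕ => seriesTerm φ (n + 1)) →
      MeasureTheory.volume (largeProductsSet φ) = 0) ∧
    (¬ Summable (fun n : ℕ => seriesTerm φ (n + 1)) →
      MeasureTheory.volume (largeProductsSet φ) = 1) := by
  have hIco : irrationalUnit =ᵐ[volume] Ico (0 : ℝ) 1 :=
    irrationalUnit_ae_eq_Ioo.trans Ioo_ae_eq_Ico
  have hvol : volume (largeProductsSet φ) = tailLaw 0 (largeProductsSet φ) := by
    rw [tailLaw_zero, Measure.restrict_congr_set hIco,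
      Measure.restrict_eq_self _ fun x hx => hx.1]
  rw [hvol]
  constructor
  · intro hs
    exact measure_eq_zero_iff_ae_notMem.2 (ae_notMem_largeProductsSet hpos hmono hs 0)
  · intro hs
    exact (measure_congr (eventuallyEq_univ.2 (ae_mem_largeProductsSet hmono hs 0))).trans
      measure_univ
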